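/- Let $F$ be an absolutely continuous cumulative distribution function on $\mathbb R$ with $F(x)=0$ for $x<0$ and $\int_0^\infty (1-F(x))^2\,dx<\infty$. Call $F$ IOR (increasing odds rate) if its odds function $\Lambda_F=F/(1-F)$ is convex on $\{x: F(x)<1\}$. For a sample $X_1,\dots,X_n$ with empirical CDF $\mathbb F_n$ and order statistics $X_{(1)}\le\dots\le X_{(n)}$, $X_{(0)}:=0$, let $T_n^{-1}:[0,1]\to[0,\infty)$ be the piecewise linear interpolation of the points $$\Bigl(\tfrac kn,\ \int_0^{X_{(k)}}(1-\mathbb F_n(t))^2\,dt\Bigr),\qquad k=0,\dots,n,$$ let $\overline T_n^{-1}(p)=T_n^{-1}(p)/T_n^{-1}(1)$, let $\overline T_n:[0,1]\to[0,1]$ be the inverse function of $\overline T_n^{-1}$ (almost surely well defined), and let $(\overline T_n)_{cx}$ be the greatest convex minorant of $\overline T_n$ on $[0,1]$. Put $$\mathrm{KT}(\mathbb F_n)=\sup_{u\in[0,1]}\bigl|\overline T_n(u)-(\overline T_n)_{cx}(u)\bigr|.$$ Let $\mathbb L_n$ be the empirical CDF of a random sample of size $n$ from the LL(1) distribution, whose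 CDF is $L(x)=x/(1+x)$ for $x>0$ and $L(x)=0$ for $x\le 0$. Fix $\alpha\in(0,1)$ and, for all sufficiently large $n$, let $c_{\alpha,n}$ be a critical value calibrated under LL(1), that is, any number with $$P(\mathrm{KT}(\mathbb L_n)>c_{\alpha,n})\le\alpha\le P(\mathrm{KT}(\mathbb L_n)\ge c_{\alpha,n})$$ (in particular, any solution of $P(\mathrm{KT}(\mathbb L_n)\ge c_{\alpha,n})=\alpha$). If $F$ is not IOR and $\mathbb F_n$ is the empirical CDF of a random sample of size $n$ from $F$, then $$\lim_{n\to\infty}P\bigl(\mathrm{KT}(\mathbb F_n)>c_{\alpha,n}\bigr)=1.$$ Moreover, $c_{\alpha,n}\to0$ as $n\to\infty$, and there is $\delta>0$ such that $P(\mathrm{KT}(\mathbb F_n)\ge\delta)\to1$. -/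

import Mathlib

open MeasureTheory ProbabilityTheory Set Filter Topology

noncomputable section

namespace IORTest

/-- The odds function `F / (1 - F)` of a distribution on `ℝ` with CDF `F`. It is meaningful on
`{x | F x < 1}`; beyond that set the odds are `+∞`. -/
def odds (μ : Measure ℝ) (x : ℝ) : ℝ := cdf μ x / (1 - cdf μ x)

/-- Increasing odds rate: the odds function is convex (where it is finite). -/
def IsIOR (μ : Measure ℝ) : Prop := ConvexOn ℝ {x | cdf μ x < 1} (odds μ)

/-- The CDF `L(x) = x / (1 + x)`, `x > 0`, of the LL(1) distribution, as a Stieltjes function. -/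
def ll1CDF : StieltjesFunction ℝ where
  toFun x := if 0 < x then x / (1 + x) else 0
  mono' := by
    intro a b hab
    dsimp only
    split_ifs with ha hb hb
    · rw [div_le_div_iff₀ (by linarith) (by linarith)]; nlinarith
    · exact absurd (lt_of_lt_of_le ha hab) hb
    · positivity
    · exact le_rfl
  right_continuous' := by
    intro a
    apply Continuous.continuousWithinAt
    have h : (fun x : ℝ => if 0 < x then x / (1 + x) else 0) =
        fun x => max x 0 / (1 + max x 0) := by
      funext x
      split_ifs with hx
      · rw [max_eq_left hx.le]
      · rw [max_eq_right (not_lt.mp hx)]; simp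
    rw [h]
    refine Continuous.div (by fun_prop) (by fun_prop) fun x => ?_
    have := le_max_right x 0
    positivity

/-- The LL(1) distribution. -/
def ll1 : Measure ℝ := ll1CDF.measure

theorem ll1CDF_tendsto_atBot : Tendsto ll1CDF atBot (𝓝 0) := by
  refine tendsto_const_nhds.congr' ?_
  filter_upwards [eventually_le_atBot (0 : ℝ)] with x hx
  exact (if_neg (not_lt.mpr hx)).symm

theorem ll1CDF_tendsto_atTop : Tendsto ll1CDF atTop (𝓝 1) := by
  have h : Tendsto (fun x : ℝ => 1 - (1 + x)⁻¹) atTop (𝓝 (1 - 0)) :=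
    tendsto_const_nhds.sub
      (tendsto_inv_atTop_zero.comp (tendsto_atTop_add_const_left _ 1 tendsto_id))
  rw [sub_zero] at h
  refine h.congr' ?_
  filter_upwards [eventually_gt_atTop (0 : ℝ)] with x hx
  have h2 : ll1CDF x = x / (1 + x) := if_pos hx
  rw [h2]
  field_simp
  ring

instance : IsProbabilityMeasure ll1 :=
  ll1CDF.isProbabilityMeasure ll1CDF_tendsto_atBot ll1CDF_tendsto_atTop

theorem cdf_ll1 (x : ℝ) : cdf ll1 x = if 0 < x then x / (1 + x) else 0 := by
  have h : cdf ll1 = ll1CDF := cdf_measure_stieltjesFunction _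
    ll1CDF_tendsto_atBot ll1CDF_tendsto_atTop
  rw [h]; rfl

/-- The law of a random sample of size `n` from `μ`: `n` independent draws. -/
def sampleLaw (μ : Measure ℝ) (n : ℕ) : Measure (Fin n → ℝ) := Measure.pi fun _ => μ

/-- The empirical CDF of the sample `x`. -/
def ecdf {n : ℕ} (x : Fin n → ℝ) (t : ℝ) : ℝ :=
  (∑ i, if x i ≤ t then (1 : ℝ) else 0) / n

/-- The order statistics `x₍₁₎ ≤ … ≤ x₍ₙ₎`, with `x₍₀₎ = 0`. -/
def orderStat {n : ℕ} (x : Fin n → ℝ) (k : ℕ) : ℝ :=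
  if h : 1 ≤ k ∧ k ≤ n then x (Tuple.sort x ⟨k - 1, by omega⟩) else 0

/-- The value of the empirical transform at `k / n`: `∫₀^{x₍ₖ₎} (1 - Fₙ(t))² dt`. -/
def tttNode {n : ℕ} (x : Fin n → ℝ) (k : ℕ) : ℝ :=
  ∫ t in (0 : ℝ)..orderStat x k, (1 - ecdf x t) ^ 2

/-- The empirical transform `Tₙ⁻¹` on `[0,1]`: the piecewise linear interpolation of the points
`(k / n, tttNode x k)`, `k = 0, …, n`. -/
def tttInv {n : ℕ} (x : Fin n → ℝ) (p : ℝ) : ℝ :=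
  tttNode x ⌊n * p⌋₊ + (n * p - ⌊n * p⌋₊) * (tttNode x (⌊n * p⌋₊ + 1) - tttNode x ⌊n * p⌋₊)

/-- The scale-free version `Tₙ⁻¹(p) / Tₙ⁻¹(1)`. -/
def tttInvBar {n : ℕ} (x : Fin n → ℝ) (p : ℝ) : ℝ := tttInv x p / tttInv x 1

/-- The inverse function of `tttInvBar x : [0,1] → [0,1]`, which is an increasing bijection whenever
the sample points are positive and distinct. -/
def tttBar {n : ℕ} (x : Fin n → ℝ) (u : ℝ) : ℝ :=
  sInf {p | p ∈ Icc (0 : ℝ) 1 ∧ u ≤ tttInvBar x p}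

/-- The greatest convex minorant of `g` on `s`: the pointwise supremum of all convex functions
on `s` that do not exceed `g` there. -/
def gcm (s : Set ℝ) (g : ℝ → ℝ) (u : ℝ) : ℝ :=
  sSup {y | ∃ h : ℝ → ℝ, ConvexOn ℝ s h ∧ (∀ v ∈ s, h v ≤ g v) ∧ y = h u}

/-- The test statistic: the uniform distance on `[0,1]` between `tttBar x` and its greatest convex
minorant. -/
def KT {n : ℕ} (x : Fin n → ℝ) : ℝ :=
  ⨆ u : Icc (0 : ℝ) 1, |tttBar x u - gcm (Icc 0 1) (tttBar x) u|

/-- `c` is a critical value of level `α` for samples of size `n`, calibrated under LL(1): it is an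
upper `α`-quantile of the statistic. Every solution of `P(KT ≥ c) = α` is one, and the two notions
agree when the statistic has no atom at `c`; but at small `n` that equation may have no solution,
since the statistic vanishes with positive probability. -/
def IsCriticalValue (α : ℝ) (n : ℕ) (c : ℝ) : Prop :=
  (sampleLaw ll1 n).real {x | c < KT x} ≤ α ∧ α ≤ (sampleLaw ll1 n).real {x | c ≤ KT x}

instance (μ : Measure ℝ) [IsProbabilityMeasure μ] (n : ℕ) :
    IsProbabilityMeasure (sampleLaw μ n) := by
  unfold sampleLaw; infer_instance

theorem isCriticalValue_of_eq {α : ℝ} {n : ℕ} {c : ℝ}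
    (h : (sampleLaw ll1 n).real {x | c ≤ KT x} = α) : IsCriticalValue α n c :=
  ⟨h ▸ measureReal_mono fun x (hx : c < KT x) => hx.le, h.ge⟩

end IORTest

end

/-! Write G(t) = ∫₀ᵗ (1 - F)² and H = ∫₀^∞ (1 - F)². The population version of `tttBar` is T(u) =
F(G⁻¹(uH)). Since G' = (1 - F)², the odds F/(1 - F) and the composite F ∘ G⁻¹ have matching slopes:
the derivative of the odds at x is that of F ∘ G⁻¹ at G(x). Hence a convex T forces F to be IOR, and
for F not IOR some chord of T lies strictly below its graph (`isIOR_of_chord_le`,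
`exists_chord_lt`). For LL(1), G = F on [0,∞) and H = 1, so T is the identity.

The probabilistic input is uniform convergence in probability of the empirical G, together with its
total mass (`withHighProb_empSurvSq`). The mean may be infinite, as it is for LL(1), so the tail is
cut at a level that the sample exceeds with small probability, and below it the L² error is
controlled by integrability of (1 - F)² alone. Inverting gives `tttBar` → T pointwise.

A strict chord violation of T survives in the sample and bounds `KT` below (`sub_chord_le_KT`).
Under LL(1), closeness to the identity bounds `KT` above (`KT_le_of_abs_sub_le`), which drives the
critical values to 0. -/

namespace IORTest

/-! ### Order statistics, the empirical transform and its inverse -/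

section EmpiricalTransform

variable {n : ℕ} {x : Fin n → ℝ}

theorem ecdf_eq_card (x : Fin n → ℝ) (t : ℝ) :
    ecdf x t = ((Finset.univ.filter fun i => x i ≤ t).card : ℝ) / n := by
  simp [ecdf]

theorem ecdf_nonneg (x : Fin n → ℝ) (t : ℝ) : 0 ≤ ecdf x t := by
  rw [ecdf_eq_card]; positivity

theorem ecdf_le_one (x : Fin n → ℝ) (t : ℝ) : ecdf x t ≤ 1 := by
  rw [ecdf_eq_card]
  refine div_le_one_of_le₀ ?_ (Nat.cast_nonneg n)
  exact_mod_cast (Finset.card_le_univ _).trans_eq (Fintype.card_fin n)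

theorem monotone_ecdf (x : Fin n → ℝ) : Monotone (ecdf x) := by
  intro s t hst
  rw [ecdf_eq_card, ecdf_eq_card]
  gcongr

theorem ecdf_eq_one (hn : n ≠ 0) {t : ℝ} (h : ∀ i, x i ≤ t) : ecdf x t = 1 := by
  rw [ecdf_eq_card, Finset.filter_true_of_mem fun i _ => h i, Finset.card_univ, Fintype.card_fin]
  exact div_self (Nat.cast_ne_zero.mpr hn)

theorem antitone_sq_one_sub_ecdf (x : Fin n → ℝ) : Antitone fun t => (1 - ecdf x t) ^ 2 := by
  intro s t hst
  have := monotone_ecdf x hst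
  have := ecdf_le_one x t
  exact pow_le_pow_left₀ (by linarith) (by linarith) 2

/-- `∫₀ᵗ (1 - Fₙ)²`. -/
noncomputable def empSurvSq (x : Fin n → ℝ) (t : ℝ) : ℝ :=
  ∫ s in (0 : ℝ)..t, (1 - ecdf x s) ^ 2

theorem tttNode_eq (x : Fin n → ℝ) (k : ℕ) : tttNode x k = empSurvSq x (orderStat x k) := rfl

theorem empSurvSq_sub (x : Fin n → ℝ) (s t : ℝ) :
    empSurvSq x t - empSurvSq x s = ∫ r in s..t, (1 - ecdf x r) ^ 2 :=
  intervalIntegral.integral_interval_sub_left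
    (antitone_sq_one_sub_ecdf x).intervalIntegrable (antitone_sq_one_sub_ecdf x).intervalIntegrable

theorem monotone_empSurvSq (x : Fin n → ℝ) : Monotone (empSurvSq x) := by
  intro s t hst
  have h : 0 ≤ ∫ r in s..t, (1 - ecdf x r) ^ 2 :=
    intervalIntegral.integral_nonneg hst fun r _ => sq_nonneg _
  rw [← empSurvSq_sub] at h
  linarith

/-- Sorting permutes the sample, so counts below a level are unchanged. This duality turns questions
about order statistics into questions about `ecdf`. -/
theorem orderStat_le_iff {k : ℕ} (hk : 1 ≤ k) (hkn : k ≤ n) (t : ℝ) :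
    orderStat x k ≤ t ↔ k ≤ (Finset.univ.filter fun i => x i ≤ t).card := by
  have h := Tuple.lt_card_le_iff_apply_le_of_monotone (f := x ∘ Tuple.sort x)
    (j := ⟨k - 1, by omega⟩) (a := t) (Tuple.monotone_sort x)
  have hc : (Finset.univ.filter fun i => (x ∘ Tuple.sort x) i ≤ t).card =
      (Finset.univ.filter fun i => x i ≤ t).card :=
    Finset.card_equiv (Tuple.sort x) (by simp)
  rw [hc] at h
  rw [orderStat, dif_pos ⟨hk, hkn⟩]
  refine h.symm.trans ?_
  simp only
  omega

theorem orderStat_zero (x : Fin n → ℝ) : orderStat x 0 = 0 := by simp [orderStat]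

theorem orderStat_mono (h0 : ∀ i, 0 ≤ x i) {j k : ℕ} (hjk : j ≤ k) (hkn : k ≤ n) :
    orderStat x j ≤ orderStat x k := by
  rcases Nat.eq_zero_or_pos j with rfl | hj
  · rw [orderStat_zero, orderStat]
    split_ifs
    · exact h0 _
    · exact le_rfl
  · rw [orderStat_le_iff hj (hjk.trans hkn)]
    exact hjk.trans ((orderStat_le_iff (hj.trans_le hjk) hkn _).mp le_rfl)

theorem tttNode_mono (h0 : ∀ i, 0 ≤ x i) {j k : ℕ} (hjk : j ≤ k) (hkn : k ≤ n) :
    tttNode x j ≤ tttNode x k :=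
  monotone_empSurvSq x (orderStat_mono h0 hjk hkn)

theorem tttInv_div (hn : n ≠ 0) (x : Fin n → ℝ) (k : ℕ) :
    tttInv x ((k : ℝ) / n) = tttNode x k := by
  have : (n : ℝ) * (k / n) = k := mul_div_cancel₀ _ (Nat.cast_ne_zero.mpr hn)
  simp [tttInv, this]

/-- The interpolation formula at 1 also mentions node n + 1, where `orderStat` has its default value
0, but with weight 0. -/
theorem tttInv_one (x : Fin n → ℝ) : tttInv x 1 = tttNode x n := by
  simp [tttInv]

/-- Beyond the largest observation the integrand 1 - Fₙ vanishes. -/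
theorem tttInv_one_eq (hn : n ≠ 0) {t : ℝ} (h : ∀ i, x i ≤ t) : tttInv x 1 = empSurvSq x t := by
  have hle : orderStat x n ≤ t := by
    rw [orderStat, dif_pos ⟨Nat.one_le_iff_ne_zero.mpr hn, le_rfl⟩]
    exact h _
  have hn' := Nat.one_le_iff_ne_zero.mpr hn
  have hz : ∫ r in orderStat x n..t, (1 - ecdf x r) ^ 2 = 0 := by
    refine intervalIntegral.integral_zero_ae (Eventually.of_forall fun r hr => ?_)
    rw [uIoc_of_le hle] at hr
    rw [ecdf_eq_one hn, sub_self, zero_pow two_ne_zero]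
    intro i
    have hc := (orderStat_le_iff hn' le_rfl r).mp hr.1.le
    have : (Finset.univ.filter fun i => x i ≤ r) = Finset.univ := by
      refine Finset.eq_univ_of_card _ (le_antisymm (Finset.card_le_univ _) ?_)
      simpa using hc
    have hi := Finset.mem_univ i
    rw [← this, Finset.mem_filter] at hi
    exact hi.2
  rw [tttInv_one, tttNode_eq]
  have := empSurvSq_sub x (orderStat x n) t
  rw [hz] at this
  linarith

theorem tttInv_le (hn : n ≠ 0) (h0 : ∀ i, 0 ≤ x i) {k : ℕ} (hk : k ≤ n) {p : ℝ} (hp0 : 0 ≤ p)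
    (hp : p < (k : ℝ) / n) : tttInv x p ≤ tttNode x k := by
  have hnpos : (0 : ℝ) < n := by positivity
  rw [lt_div_iff₀ hnpos] at hp
  have hnp : 0 ≤ (n : ℝ) * p := by positivity
  have hlt : ⌊(n : ℝ) * p⌋₊ < k := (Nat.floor_lt hnp).mpr (by linarith)
  have h1 := Nat.floor_le hnp
  have h2 := Nat.lt_floor_add_one ((n : ℝ) * p)
  have h3 := tttNode_mono h0 (show ⌊(n : ℝ) * p⌋₊ ≤ ⌊(n : ℝ) * p⌋₊ + 1 by omega) (by omega)
  have h4 := tttNode_mono h0 (show ⌊(n : ℝ) * p⌋₊ + 1 ≤ k by omega) hk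
  rw [tttInv]
  nlinarith [mul_nonneg (show 0 ≤ 1 - (n * p - ⌊(n : ℝ) * p⌋₊) by linarith) (sub_nonneg.mpr h3)]

theorem tttBar_nonneg (x : Fin n → ℝ) (u : ℝ) : 0 ≤ tttBar x u :=
  Real.sInf_nonneg fun _ hp => hp.1.1

theorem tttBar_le_of_mem {u p : ℝ} (hp : p ∈ Icc (0 : ℝ) 1) (h : u ≤ tttInvBar x p) :
    tttBar x u ≤ p :=
  csInf_le ⟨0, fun _ hq => hq.1.1⟩ ⟨hp, h⟩

theorem tttBar_le_one (x : Fin n → ℝ) (u : ℝ) : tttBar x u ≤ 1 := by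
  rcases Set.eq_empty_or_nonempty {p | p ∈ Icc (0 : ℝ) 1 ∧ u ≤ tttInvBar x p} with h | ⟨p, hp⟩
  · rw [tttBar, h, Real.sInf_empty]; exact zero_le_one
  · exact (tttBar_le_of_mem hp.1 hp.2).trans hp.1.2

theorem tttInvBar_one (hH : 0 < tttInv x 1) : tttInvBar x 1 = 1 := div_self hH.ne'

theorem tttBar_mono (hH : 0 < tttInv x 1) {u v : ℝ} (huv : u ≤ v) (hv : v ≤ 1) :
    tttBar x u ≤ tttBar x v :=
  csInf_le_csInf ⟨0, fun _ hq => hq.1.1⟩ ⟨1, ⟨zero_le_one, le_rfl⟩, hv.trans (tttInvBar_one hH).ge⟩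
    fun _ hp => ⟨hp.1, huv.trans hp.2⟩

/-- With k observations up to t, the next order statistic exceeds t, so node k + 1 has already
reached the required height. The term 1/n is the price of moving to that node. -/
theorem tttBar_le_ecdf_add (hn : n ≠ 0) (hH : 0 < tttInv x 1) {u t : ℝ}
    (hu : u * tttInv x 1 ≤ empSurvSq x t) : tttBar x u ≤ ecdf x t + 1 / n := by
  have hnpos : (0 : ℝ) < n := by positivity
  rw [ecdf_eq_card, ← add_div]
  set k := (Finset.univ.filter fun i => x i ≤ t).card with hk
  have hkn : k ≤ n := (Finset.card_le_univ _).trans_eq (Fintype.card_fin n)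
  rcases hkn.lt_or_eq with hlt | heq
  · refine tttBar_le_of_mem ⟨by positivity, ?_⟩ ?_
    · rw [div_le_one hnpos]; exact_mod_cast hlt
    · have := tttInv_div hn x (k + 1)
      push_cast at this
      rw [tttInvBar, le_div_iff₀ hH, this]
      refine hu.trans (monotone_empSurvSq x ?_)
      by_contra hcon
      have := (orderStat_le_iff (k := k + 1) (by omega) (by omega) t).mp (not_le.mp hcon).le
      omega
  · refine (tttBar_le_one x u).trans ?_
    rw [heq, one_le_div hnpos]
    linarith

/-- With k observations up to t, every p < k/n stays at or below node k, which is at most the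
integral up to t and hence too low to qualify in the infimum. -/
theorem ecdf_le_tttBar (hn : n ≠ 0) (h0 : ∀ i, 0 ≤ x i) (hH : 0 < tttInv x 1) {u t : ℝ}
    (ht : 0 ≤ t) (hu1 : u ≤ 1) (hu : empSurvSq x t < u * tttInv x 1) :
    ecdf x t ≤ tttBar x u := by
  refine le_csInf ⟨1, ⟨zero_le_one, le_rfl⟩, hu1.trans (tttInvBar_one hH).ge⟩ fun p hp => ?_
  by_contra! hcon
  rw [ecdf_eq_card] at hcon
  set k := (Finset.univ.filter fun i => x i ≤ t).card with hk
  have hkn : k ≤ n := (Finset.card_le_univ _).trans_eq (Fintype.card_fin n)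
  have h1 := tttInv_le hn h0 hkn hp.1.1 hcon
  have hle : orderStat x k ≤ t := by
    rcases Nat.eq_zero_or_pos k with hk0 | hkpos
    · rw [hk0, orderStat_zero]; exact ht
    · exact (orderStat_le_iff hkpos hkn t).mpr le_rfl
  have h2 := monotone_empSurvSq x hle
  have h3 := hp.2
  rw [tttInvBar, le_div_iff₀ hH] at h3
  rw [tttNode_eq] at h1
  linarith

end EmpiricalTransform

/-! ### Greatest convex minorants -/

section ConvexMinorant

variable {s : Set ℝ} {g h : ℝ → ℝ} {u : ℝ}

theorem le_gcm (hh : ConvexOn ℝ s h) (hle : ∀ v ∈ s, h v ≤ g v) (hu : u ∈ s) :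
    h u ≤ gcm s g u :=
  le_csSup ⟨g u, by rintro y ⟨k, -, hk, rfl⟩; exact hk u hu⟩ ⟨h, hh, hle, rfl⟩

/-- Nonnegativity of `g` makes the zero function a competitor, so the supremum is over a nonempty
set. -/
theorem gcm_le (hs : Convex ℝ s) (hg : ∀ v ∈ s, 0 ≤ g v) {c : ℝ}
    (hc : ∀ h : ℝ → ℝ, ConvexOn ℝ s h → (∀ v ∈ s, h v ≤ g v) → h u ≤ c) : gcm s g u ≤ c :=
  csSup_le ⟨0, fun _ => 0, convexOn_const 0 hs, hg, rfl⟩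
    (by rintro y ⟨k, hk, hkg, rfl⟩; exact hc k hk hkg)

theorem gcm_le_self (hs : Convex ℝ s) (hg : ∀ v ∈ s, 0 ≤ g v) (hu : u ∈ s) : gcm s g u ≤ g u :=
  gcm_le hs hg fun _ _ hk => hk u hu

theorem gcm_nonneg (hs : Convex ℝ s) (hg : ∀ v ∈ s, 0 ≤ g v) (hu : u ∈ s) : 0 ≤ gcm s g u :=
  le_gcm (h := fun _ => 0) (convexOn_const 0 hs) hg hu

end ConvexMinorant

/-! ### Deterministic bounds on the statistic -/

section Statistic

variable {n : ℕ} {x : Fin n → ℝ}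

theorem KT_nonneg (x : Fin n → ℝ) : 0 ≤ KT x := Real.iSup_nonneg fun _ => abs_nonneg _

theorem abs_tttBar_sub_gcm_le_KT (x : Fin n → ℝ) {u : ℝ} (hu : u ∈ Icc (0 : ℝ) 1) :
    |tttBar x u - gcm (Icc 0 1) (tttBar x) u| ≤ KT x := by
  refine le_ciSup (f := fun u : Icc (0 : ℝ) 1 =>
    |tttBar x u - gcm (Icc 0 1) (tttBar x) u|) ⟨1, ?_⟩ ⟨u, hu⟩
  rintro _ ⟨v, rfl⟩
  have h1 := gcm_nonneg (convex_Icc (0 : ℝ) 1) (fun w _ => tttBar_nonneg x w) v.2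
  have h2 := gcm_le_self (convex_Icc (0 : ℝ) 1) (fun w _ => tttBar_nonneg x w) v.2
  have h3 := tttBar_le_one x v
  exact abs_le.mpr ⟨by linarith, by linarith⟩

/-- Every convex function below `tttBar x` lies below the chord of `tttBar x`, and so does their
supremum. -/
theorem sub_chord_le_KT (x : Fin n → ℝ) {u v a b : ℝ} (hu : u ∈ Icc (0 : ℝ) 1)
    (hv : v ∈ Icc (0 : ℝ) 1) (ha : 0 ≤ a) (hb : 0 ≤ b) (hab : a + b = 1) :
    tttBar x (a * u + b * v) - (a * tttBar x u + b * tttBar x v) ≤ KT x := by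
  have hw : a * u + b * v ∈ Icc (0 : ℝ) 1 := convex_Icc (0 : ℝ) 1 hu hv ha hb hab
  refine le_trans ?_ ((le_abs_self _).trans (abs_tttBar_sub_gcm_le_KT x hw))
  refine sub_le_sub_left (gcm_le (convex_Icc 0 1) (fun w _ => tttBar_nonneg x w) ?_) _
  intro h hh hle
  exact (hh.2 hu hv ha hb hab).trans (add_le_add (mul_le_mul_of_nonneg_left (hle u hu) ha)
    (mul_le_mul_of_nonneg_left (hle v hv) hb))

theorem KT_le_of_abs_sub_le {η : ℝ} (h : ∀ u ∈ Icc (0 : ℝ) 1, |tttBar x u - u| ≤ η) :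
    KT x ≤ 2 * η := by
  have : Nonempty (Icc (0 : ℝ) 1) := ⟨⟨0, le_rfl, zero_le_one⟩⟩
  refine ciSup_le fun u => ?_
  -- The identity shifted down by η is a convex minorant.
  have h1 : (u : ℝ) - η ≤ gcm (Icc 0 1) (tttBar x) u := by
    refine le_gcm (h := fun v => v - η) ?_ (fun v hv => ?_) u.2
    · exact (convexOn_id (convex_Icc 0 1)).sub (concaveOn_const η (convex_Icc 0 1))
    · linarith [(abs_le.mp (h v hv)).1]
  have h2 := gcm_le_self (convex_Icc (0 : ℝ) 1) (fun w _ => tttBar_nonneg x w) u.2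
  rw [abs_of_nonneg (by linarith)]
  linarith [(abs_le.mp (h u u.2)).2]

end Statistic

/-! ### The population transform -/

section Population

variable (μ : Measure ℝ)

theorem antitone_sq_one_sub_cdf : Antitone fun t => (1 - cdf μ t) ^ 2 := by
  intro s t hst
  have := monotone_cdf μ hst
  have := cdf_le_one μ t
  exact pow_le_pow_left₀ (by linarith) (by linarith) 2

/-- `∫₀ᵗ (1 - F)²`. -/
noncomputable def survSq (t : ℝ) : ℝ := ∫ s in (0 : ℝ)..t, (1 - cdf μ s) ^ 2

/-- `∫₀^∞ (1 - F)²`. -/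
noncomputable def survSqTotal : ℝ := ∫ s in Ioi (0 : ℝ), (1 - cdf μ s) ^ 2

theorem survSq_sub (s t : ℝ) :
    survSq μ t - survSq μ s = ∫ r in s..t, (1 - cdf μ r) ^ 2 :=
  intervalIntegral.integral_interval_sub_left
    (antitone_sq_one_sub_cdf μ).intervalIntegrable (antitone_sq_one_sub_cdf μ).intervalIntegrable

theorem monotone_survSq : Monotone (survSq μ) := by
  intro s t hst
  have h : 0 ≤ ∫ r in s..t, (1 - cdf μ r) ^ 2 :=
    intervalIntegral.integral_nonneg hst fun r _ => sq_nonneg _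
  rw [← survSq_sub] at h
  linarith

theorem survSq_zero : survSq μ 0 = 0 := intervalIntegral.integral_same

/-- On [s, t] the integrand is at least its value at t, which is positive. -/
theorem survSq_lt {s t : ℝ} (hst : s < t) (ht : cdf μ t < 1) : survSq μ s < survSq μ t := by
  have h : ∫ r in s..t, (1 - cdf μ t) ^ 2 ≤ ∫ r in s..t, (1 - cdf μ r) ^ 2 :=
    intervalIntegral.integral_mono_on hst.le (by simp)
      (antitone_sq_one_sub_cdf μ).intervalIntegrable fun r hr => antitone_sq_one_sub_cdf μ hr.2
  rw [← survSq_sub, intervalIntegral.integral_const, smul_eq_mul] at h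
  have : 0 < (t - s) * (1 - cdf μ t) ^ 2 :=
    mul_pos (sub_pos.mpr hst) (pow_pos (sub_pos.mpr ht) 2)
  linarith

variable {μ}

theorem survSqTotal_sub (hfin : IntegrableOn (fun x => (1 - cdf μ x) ^ 2) (Ioi 0) volume)
    {t : ℝ} (ht : 0 ≤ t) : survSqTotal μ - survSq μ t = ∫ s in Ioi t, (1 - cdf μ s) ^ 2 := by
  rw [survSqTotal, survSq, ← intervalIntegral.integral_interval_add_Ioi hfin
    (hfin.mono_set (Ioi_subset_Ioi ht))]
  ring

theorem survSq_le_total (hfin : IntegrableOn (fun x => (1 - cdf μ x) ^ 2) (Ioi 0) volume)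
    {t : ℝ} (ht : 0 ≤ t) : survSq μ t ≤ survSqTotal μ := by
  have h : 0 ≤ ∫ s in Ioi t, (1 - cdf μ s) ^ 2 := integral_nonneg fun _ => sq_nonneg _
  rw [← survSqTotal_sub hfin ht] at h
  linarith

end Population

/-! ### Events of probability tending to one -/

section HighProbability

/-- The event `P n` has probability tending to `1` under the law of a sample of size `n`. -/
def WithHighProb (μ : Measure ℝ) (P : ∀ n, (Fin n → ℝ) → Prop) : Prop :=
  Tendsto (fun n => sampleLaw μ n {x | ¬ P n x}) atTop (𝓝 0)

variable {μ : Measure ℝ} {P Q : ∀ n, (Fin n → ℝ) → Prop}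

theorem WithHighProb.mono' (hP : WithHighProb μ P) (h : ∀ᶠ n in atTop, ∀ x, P n x → Q n x) :
    WithHighProb μ Q := by
  refine tendsto_of_tendsto_of_tendsto_of_le_of_le' tendsto_const_nhds hP
    (Eventually.of_forall fun _ => zero_le) ?_
  filter_upwards [h] with n hn
  exact measure_mono fun x hx hp => hx (hn x hp)

theorem WithHighProb.and (hP : WithHighProb μ P) (hQ : WithHighProb μ Q) :
    WithHighProb μ fun n x => P n x ∧ Q n x := by
  have h := Tendsto.add hP hQ
  rw [add_zero] at h
  refine tendsto_of_tendsto_of_tendsto_of_le_of_le tendsto_const_nhds h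
    (fun _ => zero_le) fun n => (measure_mono fun x hx => ?_).trans (measure_union_le _ _)
  by_cases hp : P n x
  · exact Or.inr fun hq => hx ⟨hp, hq⟩
  · exact Or.inl hp

theorem withHighProb_of_forall (h : ∀ᶠ n in atTop, ∀ x, P n x) : WithHighProb μ P := by
  refine tendsto_const_nhds.congr' ?_
  filter_upwards [h] with n hn
  simp [hn]

theorem withHighProb_forall_lt {P : ℕ → ∀ n, (Fin n → ℝ) → Prop} (m : ℕ)
    (h : ∀ j < m, WithHighProb μ (P j)) : WithHighProb μ fun n x => ∀ j < m, P j n x := by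
  induction m with
  | zero => exact withHighProb_of_forall (Eventually.of_forall fun _ _ _ hj => absurd hj (by omega))
  | succ m ih =>
    refine ((ih fun j hj => h j (by omega)).and (h m (by omega))).mono'
      (Eventually.of_forall fun n x hx j hj => ?_)
    rcases (Nat.lt_succ_iff_lt_or_eq.mp hj) with hj | rfl
    · exact hx.1 j hj
    · exact hx.2

theorem WithHighProb.tendsto_real_not (hP : WithHighProb μ P) :
    Tendsto (fun n => (sampleLaw μ n).real {x | ¬ P n x}) atTop (𝓝 0) :=
  (ENNReal.tendsto_toReal ENNReal.zero_ne_top).comp hP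

/-- Events about `KT` are not shown measurable, so the lower bound uses subadditivity over the event
and its complement. -/
theorem WithHighProb.tendsto_real [IsProbabilityMeasure μ] (hP : WithHighProb μ P) :
    Tendsto (fun n => (sampleLaw μ n).real {x | P n x}) atTop (𝓝 1) := by
  have h1 : Tendsto (fun n => 1 - (sampleLaw μ n).real {x | ¬ P n x}) atTop (𝓝 (1 - 0)) :=
    tendsto_const_nhds.sub hP.tendsto_real_not
  rw [sub_zero] at h1
  refine tendsto_of_tendsto_of_tendsto_of_le_of_le h1 tendsto_const_nhds (fun n => ?_)
    fun n => measureReal_le_one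
  have h2 := measureReal_union_le (μ := sampleLaw μ n) {x | P n x} {x | ¬ P n x}
  have h3 : {x | P n x} ∪ {x | ¬ P n x} = univ := union_compl_self {x | P n x}
  rw [h3, probReal_univ] at h2
  simp only
  linarith

end HighProbability

/-! ### Mean and variance of the empirical survival function -/

section EmpiricalProcess

variable {μ : Measure ℝ} [IsProbabilityMeasure μ] {n : ℕ}

theorem one_sub_ecdf_eq (hn : n ≠ 0) (x : Fin n → ℝ) (t : ℝ) :
    1 - ecdf x t = (n : ℝ)⁻¹ * ∑ i, (Ioi t).indicator 1 (x i) := by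
  have hn' : (n : ℝ) ≠ 0 := Nat.cast_ne_zero.mpr hn
  have h : ∀ i, (Ioi t).indicator (1 : ℝ → ℝ) (x i) = 1 - if x i ≤ t then (1 : ℝ) else 0 := by
    intro i
    by_cases hi : x i ≤ t
    · simp [hi]
    · simp [hi, not_le.mp hi]
  simp only [h, Finset.sum_sub_distrib, ecdf]
  simp
  field_simp

theorem measureReal_Ioi_eq (t : ℝ) : μ.real (Ioi t) = 1 - cdf μ t := by
  rw [cdf_eq_real, ← compl_Iic, probReal_compl_eq_one_sub measurableSet_Iic]

theorem measurable_ecdf_uncurry :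
    Measurable fun p : (Fin n → ℝ) × ℝ => ecdf p.1 p.2 := by
  unfold ecdf
  refine Measurable.div_const (Finset.measurable_sum _ fun i _ => ?_) _
  exact Measurable.ite (measurableSet_le (by fun_prop) (by fun_prop)) measurable_const
    measurable_const

theorem integral_one_sub_ecdf (hn : n ≠ 0) (t : ℝ) :
    ∫ x, (1 - ecdf x t) ∂sampleLaw μ n = 1 - cdf μ t := by
  have hn' : (n : ℝ) ≠ 0 := Nat.cast_ne_zero.mpr hn
  simp only [one_sub_ecdf_eq hn]
  rw [integral_const_mul, integral_finsetSum]
  · have : ∀ i : Fin n, ∫ x, (Ioi t).indicator (1 : ℝ → ℝ) (x i) ∂sampleLaw μ n = 1 - cdf μ t := by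
      intro i
      rw [← measureReal_Ioi_eq, ← integral_indicator_one measurableSet_Ioi]
      rw [sampleLaw]
      exact integral_comp_eval (μ := fun _ : Fin n => μ) (i := i)
        ((measurable_one.indicator measurableSet_Ioi).aestronglyMeasurable)
    simp only [this, Finset.sum_const, Finset.card_univ, Fintype.card_fin, nsmul_eq_mul]
    field_simp
  · intro i _
    refine Integrable.of_bound (C := 1) ?_ (Eventually.of_forall fun x => ?_)
    · exact ((measurable_one.indicator measurableSet_Ioi).comp
        (measurable_pi_apply i)).aestronglyMeasurable
    · by_cases h : t < x i <;> simp [h]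

/-- The variance of an indicator is at most its mean. Keeping the factor 1 - F(t), rather than a
constant, is what later allows integration over t. -/
theorem variance_one_sub_ecdf_le (hn : n ≠ 0) (t : ℝ) :
    Var[fun x => 1 - ecdf x t; sampleLaw μ n] ≤ (1 - cdf μ t) / n := by
  have hn' : (n : ℝ) ≠ 0 := Nat.cast_ne_zero.mpr hn
  have hm : Measurable ((Ioi t).indicator (1 : ℝ → ℝ)) := measurable_one.indicator measurableSet_Ioi
  have h1 : Var[∑ i : Fin n, fun x : Fin n → ℝ => (Ioi t).indicator (1 : ℝ → ℝ) (x i);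
      sampleLaw μ n] = ∑ i : Fin n, Var[(Ioi t).indicator (1 : ℝ → ℝ); μ] := by
    refine variance_sum_pi (μ := fun _ : Fin n => μ)
      (X := fun _ => (Ioi t).indicator (1 : ℝ → ℝ)) fun i => ?_
    refine MemLp.of_bound hm.aestronglyMeasurable 1 (Eventually.of_forall fun x => ?_)
    by_cases h : t < x <;> simp [h]
  have h2 : Var[(Ioi t).indicator (1 : ℝ → ℝ); μ] ≤ 1 - cdf μ t := by
    refine (variance_le_expectation_sq hm.aestronglyMeasurable).trans_eq ?_
    rw [← measureReal_Ioi_eq, ← integral_indicator_one measurableSet_Ioi]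
    congr 1
    ext x
    by_cases h : t < x <;> simp [h]
  have h3 : (fun x : Fin n → ℝ => 1 - ecdf x t) = fun x => (n : ℝ)⁻¹ *
      (∑ i : Fin n, fun x : Fin n → ℝ => (Ioi t).indicator (1 : ℝ → ℝ) (x i)) x := by
    ext x
    rw [one_sub_ecdf_eq hn, Finset.sum_apply]
  rw [h3, variance_const_mul, h1, Finset.sum_const, Finset.card_univ, Fintype.card_fin,
    nsmul_eq_mul]
  calc ((n : ℝ)⁻¹) ^ 2 * (n * Var[(Ioi t).indicator (1 : ℝ → ℝ); μ])
      = Var[(Ioi t).indicator (1 : ℝ → ℝ); μ] / n := by field_simp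
    _ ≤ _ := by gcongr

theorem lintegral_sq_ecdf_sub_cdf_le (hn : n ≠ 0) (t : ℝ) :
    ∫⁻ x, ENNReal.ofReal ((ecdf x t - cdf μ t) ^ 2) ∂sampleLaw μ n ≤
      ENNReal.ofReal ((1 - cdf μ t) / n) := by
  have hmeas : Measurable fun x : Fin n → ℝ => 1 - ecdf x t :=
    measurable_const.sub (measurable_ecdf_uncurry.comp (measurable_id.prodMk measurable_const))
  have hL : MemLp (fun x : Fin n → ℝ => 1 - ecdf x t) 2 (sampleLaw μ n) := by
    refine MemLp.of_bound hmeas.aestronglyMeasurable 1 (Eventually.of_forall fun x => ?_)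
    rw [Real.norm_eq_abs, abs_le]
    constructor <;> linarith [ecdf_nonneg x t, ecdf_le_one x t]
  have h := ENNReal.ofReal_le_ofReal (variance_one_sub_ecdf_le (μ := μ) hn t)
  rw [ofReal_variance hL, evariance_eq_lintegral_ofReal, integral_one_sub_ecdf hn] at h
  refine le_trans (le_of_eq ?_) h
  congr 1
  ext x
  congr 1
  ring

theorem withHighProb_abs_ecdf_sub_le (μ : Measure ℝ) [IsProbabilityMeasure μ] (t : ℝ) {η : ℝ}
    (hη : 0 < η) : WithHighProb μ fun _ x => |ecdf x t - cdf μ t| ≤ η := by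
  have hlim : Tendsto (fun n : ℕ => ENNReal.ofReal ((1 - cdf μ t) / n) / ENNReal.ofReal (η ^ 2))
      atTop (𝓝 0) := by
    have h1 : Tendsto (fun n : ℕ => ENNReal.ofReal ((1 - cdf μ t) / n)) atTop (𝓝 0) := by
      have := ENNReal.tendsto_ofReal (tendsto_const_div_atTop_nhds_zero_nat (1 - cdf μ t))
      simpa using this
    have h2 := ENNReal.Tendsto.div_const h1 (b := ENNReal.ofReal (η ^ 2))
      (Or.inr (by simpa using hη.ne'))
    simpa using h2
  refine tendsto_of_tendsto_of_tendsto_of_le_of_le' tendsto_const_nhds hlim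
    (Eventually.of_forall fun _ => zero_le) ?_
  filter_upwards [eventually_ne_atTop 0] with n hn
  have hm : Measurable fun x : Fin n → ℝ => ENNReal.ofReal ((ecdf x t - cdf μ t) ^ 2) := by
    have : Measurable fun x : Fin n → ℝ => ecdf x t :=
      measurable_ecdf_uncurry.comp (measurable_id.prodMk measurable_const)
    fun_prop
  refine le_trans (measure_mono fun x hx => ?_) ((meas_ge_le_lintegral_div hm.aemeasurable
    (by simpa using hη.ne') ENNReal.ofReal_ne_top).trans
      (ENNReal.div_le_div_right (lintegral_sq_ecdf_sub_cdf_le hn t) _))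
  simp only [mem_ofPred_eq, not_le] at hx ⊢
  refine ENNReal.ofReal_le_ofReal ?_
  rw [← sq_abs (ecdf x t - cdf μ t)]
  exact pow_le_pow_left₀ hη.le hx.le 2

end EmpiricalProcess

/-! ### Uniform convergence of the empirical transform -/

section TransformConvergence

variable {μ : Measure ℝ}

/-- Dominated convergence with dominating function (1 - F)². This quantity replaces ∫ (1 - F)/n,
which may be infinite. -/
theorem tendsto_integral_surv_mul_min
    (hfin : IntegrableOn (fun x => (1 - cdf μ x) ^ 2) (Ioi 0) volume) :
    Tendsto (fun n : ℕ => ∫ s in Ioi (0 : ℝ), (1 - cdf μ s) * min (1 - cdf μ s) (1 / n))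
      atTop (𝓝 0) := by
  have hS : ∀ s, 0 ≤ 1 - cdf μ s := fun s => sub_nonneg.mpr (cdf_le_one μ s)
  have hm : Measurable fun s => 1 - cdf μ s := measurable_const.sub (monotone_cdf μ).measurable
  have h := tendsto_integral_of_dominated_convergence (μ := volume.restrict (Ioi (0 : ℝ)))
    (F := fun (n : ℕ) s => (1 - cdf μ s) * min (1 - cdf μ s) (1 / n)) (f := fun _ => 0)
    (fun s => (1 - cdf μ s) ^ 2) (fun n => (hm.mul (hm.min measurable_const)).aestronglyMeasurable)
    hfin (fun n => Eventually.of_forall fun s => ?_) (Eventually.of_forall fun s => ?_)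
  · simpa using h
  · have : 0 ≤ min (1 - cdf μ s) (1 / n) := le_min (hS s) (by positivity)
    rw [Real.norm_eq_abs, abs_of_nonneg (mul_nonneg (hS s) this), sq]
    exact mul_le_mul_of_nonneg_left (min_le_left _ _) (hS s)
  · have hlim : Tendsto (fun n : ℕ => (1 - cdf μ s) * (1 / (n : ℝ))) atTop (𝓝 0) := by
      simpa using (tendsto_one_div_atTop_nhds_zero_nat (𝕜 := ℝ)).const_mul (1 - cdf μ s)
    refine squeeze_zero (fun n => mul_nonneg (hS s) (le_min (hS s) (by positivity))) (fun n => ?_)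
      hlim
    exact mul_le_mul_of_nonneg_left (min_le_right _ _) (hS s)

theorem integrableOn_surv_mul_min
    (hfin : IntegrableOn (fun x => (1 - cdf μ x) ^ 2) (Ioi 0) volume) (n : ℕ) :
    IntegrableOn (fun s => (1 - cdf μ s) * min (1 - cdf μ s) (1 / (n : ℝ))) (Ioi 0) volume := by
  have hS : ∀ s, 0 ≤ 1 - cdf μ s := fun s => sub_nonneg.mpr (cdf_le_one μ s)
  have hm : Measurable fun s => 1 - cdf μ s := measurable_const.sub (monotone_cdf μ).measurable
  refine Integrable.mono' hfin (hm.mul (hm.min measurable_const)).aestronglyMeasurable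
    (Eventually.of_forall fun s => ?_)
  have : 0 ≤ min (1 - cdf μ s) (1 / n) := le_min (hS s) (by positivity)
  rw [Real.norm_eq_abs, abs_of_nonneg (mul_nonneg (hS s) this), sq]
  exact mul_le_mul_of_nonneg_left (min_le_left _ _) (hS s)

theorem intervalIntegrable_sq_ecdf_sub_cdf {n : ℕ} (μ : Measure ℝ) (x : Fin n → ℝ) (a b : ℝ) :
    IntervalIntegrable (fun s => (ecdf x s - cdf μ s) ^ 2) volume a b := by
  refine (intervalIntegrable_const (c := (1 : ℝ))).mono_fun ?_ (Eventually.of_forall fun s => ?_)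
  · exact (((monotone_ecdf x).measurable.sub (monotone_cdf μ).measurable).pow_const
      2).aestronglyMeasurable
  · simp only [Real.norm_eq_abs]
    rw [abs_one, abs_of_nonneg (sq_nonneg (ecdf x s - cdf μ s)), sq_le_one_iff_abs_le_one, abs_le]
    constructor <;> linarith [ecdf_nonneg x s, ecdf_le_one x s, cdf_nonneg μ s, cdf_le_one μ s]

/-- With a = 1 - F and d = Fₙ - F, Young's inequality gives |(a - d)² - a²| ≤ θa² + (1 + 1/θ)d². The
bound is uniform in t because the right side is integrated over all of [0, b]. -/
theorem abs_empSurvSq_sub_survSq_le {n : ℕ} (x : Fin n → ℝ) {b t θ : ℝ} (hθ : 0 < θ)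
    (ht0 : 0 ≤ t) (htb : t ≤ b) :
    |empSurvSq x t - survSq μ t| ≤
      θ * survSq μ b + (1 + 1 / θ) * ∫ s in (0 : ℝ)..b, (ecdf x s - cdf μ s) ^ 2 := by
  have hemp := (antitone_sq_one_sub_ecdf x).intervalIntegrable (μ := volume) (a := 0) (b := t)
  have hpop := (antitone_sq_one_sub_cdf μ).intervalIntegrable (μ := volume) (a := 0) (b := t)
  have hpop' := (antitone_sq_one_sub_cdf μ).intervalIntegrable (μ := volume) (a := 0) (b := b)
  have hdom : ∀ a b, IntervalIntegrable (fun s => θ * (1 - cdf μ s) ^ 2 +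
      (1 + 1 / θ) * (ecdf x s - cdf μ s) ^ 2) volume a b := fun a b =>
    ((antitone_sq_one_sub_cdf μ).intervalIntegrable.const_mul _).add
      ((intervalIntegrable_sq_ecdf_sub_cdf μ x a b).const_mul _)
  have hnn : ∀ s, 0 ≤ θ * (1 - cdf μ s) ^ 2 + (1 + 1 / θ) * (ecdf x s - cdf μ s) ^ 2 := by
    intro s; positivity
  rw [empSurvSq, survSq, ← intervalIntegral.integral_sub hemp hpop]
  calc |∫ s in (0 : ℝ)..t, ((1 - ecdf x s) ^ 2 - (1 - cdf μ s) ^ 2)|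
      ≤ ∫ s in (0 : ℝ)..t, |(1 - ecdf x s) ^ 2 - (1 - cdf μ s) ^ 2| :=
        intervalIntegral.abs_integral_le_integral_abs ht0
    _ ≤ ∫ s in (0 : ℝ)..t, (θ * (1 - cdf μ s) ^ 2 + (1 + 1 / θ) * (ecdf x s - cdf μ s) ^ 2) := by
        refine intervalIntegral.integral_mono_on ht0 (hemp.sub hpop).abs (hdom 0 t) fun s _ => ?_
        set a := 1 - cdf μ s
        set d := ecdf x s - cdf μ s
        have hd : 1 - ecdf x s = a - d := by simp only [a, d]; ring
        have hkey : θ * (θ * a ^ 2 + (1 + 1 / θ) * d ^ 2) = (θ * a) ^ 2 + (θ + 1) * d ^ 2 := by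
          field_simp
        rw [hd, abs_le]
        constructor
        · refine le_of_mul_le_mul_left (a := θ) ?_ hθ
          rw [mul_neg, hkey]
          nlinarith [sq_nonneg (θ * a - d), mul_nonneg hθ.le (sq_nonneg d)]
        · refine le_of_mul_le_mul_left (a := θ) ?_ hθ
          rw [hkey]
          nlinarith [sq_nonneg (θ * a + d), mul_nonneg hθ.le (sq_nonneg d)]
    _ ≤ ∫ s in (0 : ℝ)..b, (θ * (1 - cdf μ s) ^ 2 + (1 + 1 / θ) * (ecdf x s - cdf μ s) ^ 2) :=
        intervalIntegral.integral_mono_interval le_rfl ht0 htb (Eventually.of_forall hnn) (hdom 0 b)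
    _ = _ := by
        rw [intervalIntegral.integral_add (hpop'.const_mul _)
          ((intervalIntegrable_sq_ecdf_sub_cdf μ x 0 b).const_mul _),
          intervalIntegral.integral_const_mul, intervalIntegral.integral_const_mul, survSq]

theorem exists_cdf_eq (hcont : Continuous (cdf μ)) (h0 : cdf μ 0 = 0) {p : ℝ} (hp0 : 0 ≤ p)
    (hp1 : p < 1) : ∃ b, 0 ≤ b ∧ cdf μ b = p := by
  obtain ⟨M, hM, hM0⟩ := (((tendsto_cdf_atTop μ).eventually (lt_mem_nhds hp1)).and
    (eventually_ge_atTop 0)).exists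
  obtain ⟨b, hb, hbp⟩ := intermediate_value_Icc hM0 hcont.continuousOn
    (show p ∈ Icc (cdf μ 0) (cdf μ M) from ⟨by rw [h0]; exact hp0, hM.le⟩)
  exact ⟨b, hb.1, hbp⟩

variable [IsProbabilityMeasure μ]

theorem sampleLaw_not_forall_mem_le {n : ℕ} {s : Set ℝ} (hs : MeasurableSet s) :
    sampleLaw μ n {x | ¬ ∀ i, x i ∈ s} ≤ n * μ sᶜ := by
  have h : {x : Fin n → ℝ | ¬ ∀ i, x i ∈ s} = ⋃ i, Function.eval i ⁻¹' sᶜ := by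
    ext x; simp
  rw [h]
  refine (measure_iUnion_le _).trans ?_
  rw [tsum_fintype]
  have : ∀ i : Fin n, sampleLaw μ n (Function.eval i ⁻¹' sᶜ) = μ sᶜ := fun i =>
    (measurePreserving_eval (fun _ : Fin n => μ) i).measure_preimage hs.compl.nullMeasurableSet
  simp only [this, Finset.sum_const, Finset.card_univ, Fintype.card_fin, nsmul_eq_mul, le_refl]

/-- Markov's inequality and Tonelli reduce this to the variance bound ∫₀ᵇ (1 - F)/n. Up to b one has
1 - F ≥ ε/n, hence 1/n ≤ ε⁻¹ min(1 - F, 1/n). -/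
theorem sampleLaw_lt_integral_sq_le {n : ℕ} (hn : n ≠ 0)
    (hfin : IntegrableOn (fun x => (1 - cdf μ x) ^ 2) (Ioi 0) volume)
    {ε b κ : ℝ} (hε : 0 < ε) (hε1 : ε < 1) (hb0 : 0 ≤ b) (hb : 1 - cdf μ b = ε / n) (hκ : 0 < κ) :
    sampleLaw μ n {x | κ < ∫ s in (0 : ℝ)..b, (ecdf x s - cdf μ s) ^ 2} ≤
      ENNReal.ofReal ((∫ s in Ioi (0 : ℝ), (1 - cdf μ s) * min (1 - cdf μ s) (1 / n)) / ε / κ) := by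
  have hnpos : (0 : ℝ) < n := by positivity
  have hS : ∀ s, 0 ≤ 1 - cdf μ s := fun s => sub_nonneg.mpr (cdf_le_one μ s)
  have hφ : ∀ s, 0 ≤ (1 - cdf μ s) * min (1 - cdf μ s) (1 / n) := fun s =>
    mul_nonneg (hS s) (le_min (hS s) (by positivity))
  have hD : Measurable fun p : (Fin n → ℝ) × ℝ =>
      ENNReal.ofReal ((ecdf p.1 p.2 - cdf μ p.2) ^ 2) := by
    have h1 := measurable_ecdf_uncurry (n := n)
    have h2 : Measurable fun p : (Fin n → ℝ) × ℝ => cdf μ p.2 :=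
      (monotone_cdf μ).measurable.comp measurable_snd
    exact ((h1.sub h2).pow_const 2).ennreal_ofReal
  have hI : ∀ x : Fin n → ℝ, ENNReal.ofReal (∫ s in (0 : ℝ)..b, (ecdf x s - cdf μ s) ^ 2) =
      ∫⁻ s in Ioc 0 b, ENNReal.ofReal ((ecdf x s - cdf μ s) ^ 2) := by
    intro x
    rw [intervalIntegral.integral_of_le hb0]
    refine ofReal_integral_eq_lintegral_ofReal ?_ (Eventually.of_forall fun s => sq_nonneg _)
    exact (intervalIntegrable_iff_integrableOn_Ioc_of_le hb0).mp
      (intervalIntegrable_sq_ecdf_sub_cdf μ x 0 b)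
  have hE : ∫⁻ x, (∫⁻ s in Ioc 0 b, ENNReal.ofReal ((ecdf x s - cdf μ s) ^ 2)) ∂sampleLaw μ n ≤
      ENNReal.ofReal ((∫ s in Ioi (0 : ℝ), (1 - cdf μ s) * min (1 - cdf μ s) (1 / n)) / ε) := by
    rw [lintegral_lintegral_swap hD.aemeasurable, div_eq_mul_inv, mul_comm _ ε⁻¹,
      ← integral_const_mul, ofReal_integral_eq_lintegral_ofReal
        ((integrableOn_surv_mul_min hfin n).const_mul _)
        (Eventually.of_forall fun s => mul_nonneg (by positivity) (hφ s))]
    calc ∫⁻ s in Ioc 0 b, ∫⁻ x, ENNReal.ofReal ((ecdf x s - cdf μ s) ^ 2) ∂sampleLaw μ n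
        ≤ ∫⁻ s in Ioc 0 b, ENNReal.ofReal ((1 - cdf μ s) / n) :=
          lintegral_mono fun s => lintegral_sq_ecdf_sub_cdf_le hn s
      _ ≤ ∫⁻ s in Ioc 0 b, ENNReal.ofReal
            (ε⁻¹ * ((1 - cdf μ s) * min (1 - cdf μ s) (1 / n))) := by
          refine setLIntegral_mono' measurableSet_Ioc fun s hs => ENNReal.ofReal_le_ofReal ?_
          have h1 : ε / n ≤ 1 - cdf μ s := by
            rw [← hb]; linarith [monotone_cdf μ hs.2]
          have h2 : ε / n ≤ min (1 - cdf μ s) (1 / n) :=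
            le_min h1 (by gcongr)
          calc (1 - cdf μ s) / n = ε⁻¹ * ((1 - cdf μ s) * (ε / n)) := by field_simp
            _ ≤ _ := by gcongr; exact hS s
      _ ≤ _ := lintegral_mono_set Ioc_subset_Ioi_self
  have hmJ : Measurable fun x : Fin n → ℝ =>
      ∫⁻ s in Ioc 0 b, ENNReal.ofReal ((ecdf x s - cdf μ s) ^ 2) :=
    Measurable.lintegral_prod_right' hD
  rw [ENNReal.ofReal_div_of_pos hκ]
  refine le_trans (measure_mono fun x hx => ?_) ((meas_ge_le_lintegral_div hmJ.aemeasurable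
    (by simpa using hκ) ENNReal.ofReal_ne_top).trans (ENNReal.div_le_div_right hE _))
  rw [mem_ofPred_eq, ← hI]
  exact ENNReal.ofReal_le_ofReal (le_of_lt hx)

/-- Truncate at b with 1 - F(b) = ε/n. The sample stays below b outside probability ε, the L² error
on [0, b] is small outside another ε, and beyond b both transforms are nearly constant. -/
theorem withHighProb_empSurvSq (hcont : Continuous (cdf μ)) (h0 : cdf μ 0 = 0)
    (hfin : IntegrableOn (fun x => (1 - cdf μ x) ^ 2) (Ioi 0) volume) {η : ℝ} (hη : 0 < η) :
    WithHighProb μ fun _ x => (∀ i, 0 ≤ x i) ∧ |tttInv x 1 - survSqTotal μ| ≤ η ∧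
      ∀ t, 0 ≤ t → |empSurvSq x t - survSq μ t| ≤ η := by
  have hS : ∀ s, 0 ≤ 1 - cdf μ s := fun s => sub_nonneg.mpr (cdf_le_one μ s)
  have hH : 0 ≤ survSqTotal μ := integral_nonneg fun _ => sq_nonneg _
  set H := survSqTotal μ with hHdef
  set a : ℕ → ℝ := fun n => ∫ s in Ioi (0 : ℝ), (1 - cdf μ s) * min (1 - cdf μ s) (1 / n) with ha
  have hlim : Tendsto a atTop (𝓝 0) := tendsto_integral_surv_mul_min hfin
  set θ := η / (4 * (H + 1)) with hθdef
  have hθ : 0 < θ := by positivity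
  have hθH : θ * H ≤ η / 4 := by
    rw [hθdef, div_mul_eq_mul_div, div_le_div_iff₀ (by positivity) (by norm_num)]
    nlinarith
  set κ := η / 4 / (1 + 1 / θ) with hκdef
  have hκ : 0 < κ := by positivity
  have hθκ : (1 + 1 / θ) * κ = η / 4 := by rw [hκdef]; field_simp
  have main : ∀ ε : ℝ, 0 < ε → ε < 1 → ∀ᶠ n : ℕ in atTop,
      sampleLaw μ n {x | ¬ ((∀ i, 0 ≤ x i) ∧ |tttInv x 1 - H| ≤ η ∧
        ∀ t, 0 ≤ t → |empSurvSq x t - survSq μ t| ≤ η)} ≤ ENNReal.ofReal (2 * ε) := by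
    intro ε hε hε1
    filter_upwards [eventually_ne_atTop 0, hlim.eventually_le_const (show 0 < η / 4 by positivity),
      hlim.eventually_le_const (show 0 < ε * κ * ε by positivity)] with n hn ha1 ha2
    have hnpos : (0 : ℝ) < n := by positivity
    have hn1 : (1 : ℝ) ≤ n := by exact_mod_cast Nat.one_le_iff_ne_zero.mpr hn
    have hεn : ε / n ≤ 1 := by rw [div_le_one hnpos]; linarith
    have hεn0 : 0 < ε / n := by positivity
    obtain ⟨b, hb0, hb⟩ := exists_cdf_eq hcont h0 (sub_nonneg.mpr hεn) (sub_lt_self 1 hεn0)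
    have hb' : 1 - cdf μ b = ε / n := by linarith
    -- Beyond b, 1 - F ≤ 1/n, so (1 - F)² coincides with the integrand of a n.
    have htail : survSqTotal μ - survSq μ b ≤ η / 4 := by
      refine le_trans ?_ ha1
      rw [survSqTotal_sub hfin hb0]
      refine le_trans (setIntegral_mono_on (hfin.mono_set (Ioi_subset_Ioi hb0))
        ((integrableOn_surv_mul_min hfin n).mono_set (Ioi_subset_Ioi hb0)) measurableSet_Ioi
        fun s hs => ?_) (setIntegral_mono_set (integrableOn_surv_mul_min hfin n)
          (Eventually.of_forall fun s => mul_nonneg (hS s) (le_min (hS s) (by positivity)))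
          (Ioi_subset_Ioi hb0).eventuallyLE)
      have h1 : 1 - cdf μ s ≤ 1 / n := by
        have := monotone_cdf μ (le_of_lt hs)
        have : ε / n ≤ 1 / n := by gcongr
        linarith
      rw [min_eq_left h1, sq]
    have hsub : {x : Fin n → ℝ | ¬ ((∀ i, 0 ≤ x i) ∧ |tttInv x 1 - H| ≤ η ∧
        ∀ t, 0 ≤ t → |empSurvSq x t - survSq μ t| ≤ η)} ⊆
        {x | ¬ ∀ i, x i ∈ Ioi 0} ∪ ({x | ¬ ∀ i, x i ∈ Iic b} ∪
          {x | κ < ∫ s in (0 : ℝ)..b, (ecdf x s - cdf μ s) ^ 2}) := by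
      intro x hx
      by_contra hcon
      simp only [mem_union, mem_ofPred_eq, not_or, not_not, not_lt, mem_Iic, mem_Ioi] at hcon
      obtain ⟨hx0, hxb, hI⟩ := hcon
      have hclose : ∀ t, 0 ≤ t → t ≤ b → |empSurvSq x t - survSq μ t| ≤ η / 2 := by
        intro t ht0 htb
        refine (abs_empSurvSq_sub_survSq_le x hθ ht0 htb).trans ?_
        have h1 := mul_le_mul_of_nonneg_left (survSq_le_total hfin hb0) hθ.le
        have h2 := mul_le_mul_of_nonneg_left hI (show 0 ≤ 1 + 1 / θ by positivity)
        linarith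
      have hHn := tttInv_one_eq hn hxb
      have hb1 := abs_le.mp (hclose b hb0 le_rfl)
      have hb2 := survSq_le_total hfin hb0
      -- An error η/2 on [0, b] plus a population tail η/4 stays within η; the empirical transform
      -- is constant past b.
      refine hx ⟨fun i => (hx0 i).le, ?_, fun t ht0 => ?_⟩
      · rw [hHn, abs_le]; constructor <;> linarith
      · rcases le_total t b with htb | hbt
        · exact (hclose t ht0 htb).trans (by linarith)
        · have h1 := tttInv_one_eq hn fun i => (hxb i).trans hbt
          rw [hHn] at h1
          have h2 := monotone_survSq μ hbt
          have h3 := survSq_le_total hfin ht0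
          rw [← h1, abs_le]
          constructor <;> linarith
    have hp1 : sampleLaw μ n {x | ¬ ∀ i, x i ∈ Ioi 0} = 0 := by
      refine le_antisymm ((sampleLaw_not_forall_mem_le measurableSet_Ioi).trans ?_) zero_le
      rw [compl_Ioi, ← ofReal_cdf, h0, ENNReal.ofReal_zero, mul_zero]
    have hp2 : sampleLaw μ n {x | ¬ ∀ i, x i ∈ Iic b} ≤ ENNReal.ofReal ε := by
      refine (sampleLaw_not_forall_mem_le measurableSet_Iic).trans (le_of_eq ?_)
      rw [compl_Iic, ← ofReal_measureReal, measureReal_Ioi_eq, hb', ← ENNReal.ofReal_natCast,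
        ← ENNReal.ofReal_mul hnpos.le, mul_div_cancel₀ _ hnpos.ne']
    have hp3 : sampleLaw μ n {x | κ < ∫ s in (0 : ℝ)..b, (ecdf x s - cdf μ s) ^ 2} ≤
        ENNReal.ofReal ε := by
      refine (sampleLaw_lt_integral_sq_le hn hfin hε hε1 hb0 hb' hκ).trans
        (ENNReal.ofReal_le_ofReal ?_)
      rw [div_div, div_le_iff₀ (by positivity)]
      linarith
    refine (measure_mono hsub).trans ((measure_union_le _ _).trans ?_)
    rw [hp1, zero_add, two_mul, ENNReal.ofReal_add hε.le hε.le]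
    exact (measure_union_le _ _).trans (add_le_add hp2 hp3)
  refine ENNReal.tendsto_nhds_zero.mpr fun δ hδ => ?_
  rcases eq_or_ne δ ⊤ with rfl | hδt
  · exact Eventually.of_forall fun _ => le_top
  have hr : 0 < δ.toReal := ENNReal.toReal_pos hδ.ne' hδt
  filter_upwards [main (min (δ.toReal / 2) (1 / 2)) (by positivity)
    ((min_le_right _ _).trans_lt (by norm_num))] with n hn
  refine hn.trans (ENNReal.ofReal_le_of_le_toReal ?_)
  linarith [min_le_left (δ.toReal / 2) (1 / 2)]

end TransformConvergence

/-! ### Pointwise consistency of the inverse transform -/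

section InverseTransform

variable {μ : Measure ℝ}

theorem survSqTotal_pos (h0 : cdf μ 0 = 0) (hcont : Continuous (cdf μ))
    (hfin : IntegrableOn (fun x => (1 - cdf μ x) ^ 2) (Ioi 0) volume) : 0 < survSqTotal μ := by
  have h : ∀ᶠ s in 𝓝[>] (0 : ℝ), cdf μ s < 1 :=
    nhdsWithin_le_nhds (hcont.continuousAt.eventually (gt_mem_nhds (by rw [h0]; exact one_pos)))
  obtain ⟨s, hs, hs0⟩ := (h.and self_mem_nhdsWithin).exists
  have h1 := survSq_lt μ hs0 hs
  rw [survSq_zero] at h1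
  exact h1.trans_le (survSq_le_total hfin (le_of_lt hs0))

variable [IsProbabilityMeasure μ]

theorem withHighProb_tttInv_one_pos (hcont : Continuous (cdf μ)) (h0 : cdf μ 0 = 0)
    (hfin : IntegrableOn (fun x => (1 - cdf μ x) ^ 2) (Ioi 0) volume) :
    WithHighProb μ fun _ x => 0 < tttInv x 1 := by
  have hH := survSqTotal_pos h0 hcont hfin
  refine (withHighProb_empSurvSq hcont h0 hfin (half_pos hH)).mono'
    (Eventually.of_forall fun n x hx => ?_)
  linarith [(abs_le.mp hx.2.1).1]

/-- Moving slightly right of t changes F little but strictly increases G; this increase absorbs the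
errors in the empirical G and its total mass. -/
theorem withHighProb_tttBar_le (hcont : Continuous (cdf μ)) (h0 : cdf μ 0 = 0)
    (hfin : IntegrableOn (fun x => (1 - cdf μ x) ^ 2) (Ioi 0) volume) {t : ℝ} (ht : 0 ≤ t)
    (htF : cdf μ t < 1) {η : ℝ} (hη : 0 < η) :
    WithHighProb μ fun _ x => tttBar x (survSq μ t / survSqTotal μ) ≤ cdf μ t + η := by
  have hH := survSqTotal_pos h0 hcont hfin
  have h : ∀ᶠ s in 𝓝[>] t, cdf μ s < min 1 (cdf μ t + η / 3) :=
    nhdsWithin_le_nhds (hcont.continuousAt.eventually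
      (gt_mem_nhds (lt_min htF (by linarith))))
  obtain ⟨s, hs, hts⟩ := (h.and self_mem_nhdsWithin).exists
  replace hts : t < s := hts
  have hG := survSq_lt μ hts (hs.trans_le (min_le_left _ _))
  have hGs := survSq_le_total hfin (ht.trans hts.le)
  have hGt : 0 ≤ survSq μ t := survSq_zero μ ▸ monotone_survSq μ ht
  set ρ := (survSq μ s - survSq μ t) / 3 with hρdef
  have hρ : 0 < ρ := by rw [hρdef]; linarith
  refine (((withHighProb_empSurvSq hcont h0 hfin hρ).and
    (withHighProb_abs_ecdf_sub_le μ s (show 0 < η / 3 by linarith))).and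
      (withHighProb_tttInv_one_pos hcont h0 hfin)).mono' ?_
  filter_upwards [eventually_ne_atTop 0, (tendsto_one_div_atTop_nhds_zero_nat
    (𝕜 := ℝ)).eventually_le_const (show 0 < η / 3 by linarith)] with n hn hn3 x hx
  obtain ⟨⟨⟨-, hHn, hGn⟩, hF⟩, hpos⟩ := hx
  have hu1 : survSq μ t / survSqTotal μ ≤ 1 := by
    rw [div_le_one hH]; exact hG.le.trans hGs
  have hu0 : 0 ≤ survSq μ t / survSqTotal μ := by positivity
  have hcancel : survSq μ t / survSqTotal μ * survSqTotal μ = survSq μ t :=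
    div_mul_cancel₀ _ hH.ne'
  refine (tttBar_le_ecdf_add (t := s) hn hpos ?_).trans ?_
  · have h1 := (abs_le.mp (hGn s (ht.trans hts.le))).1
    have h2 := (abs_le.mp hHn).2
    nlinarith
  · have h1 := (abs_le.mp hF).2
    have h2 := hs.trans_le (min_le_right _ _)
    linarith

theorem withHighProb_le_tttBar (hcont : Continuous (cdf μ)) (h0 : cdf μ 0 = 0)
    (hfin : IntegrableOn (fun x => (1 - cdf μ x) ^ 2) (Ioi 0) volume) {t : ℝ} (ht : 0 ≤ t)
    (htF : cdf μ t < 1) {η : ℝ} (hη : 0 < η) :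
    WithHighProb μ fun _ x => cdf μ t - η ≤ tttBar x (survSq μ t / survSqTotal μ) := by
  have hH := survSqTotal_pos h0 hcont hfin
  rcases ht.eq_or_lt with rfl | htpos
  -- At t = 0 there is no room for a nonnegative s to the left, but the bound is trivial.
  · refine withHighProb_of_forall (Eventually.of_forall fun n x => ?_)
    have := tttBar_nonneg x (survSq μ 0 / survSqTotal μ)
    linarith
  have h : ∀ᶠ s in 𝓝[<] t, cdf μ t - η / 2 < cdf μ s ∧ 0 < s :=
    nhdsWithin_le_nhds ((hcont.continuousAt.eventually
      (lt_mem_nhds (by linarith))).and (lt_mem_nhds htpos))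
  obtain ⟨s, ⟨hs, hs0⟩, hst⟩ := (h.and self_mem_nhdsWithin).exists
  replace hst : s < t := hst
  have hG := survSq_lt μ hst htF
  have hGt' := survSq_le_total hfin ht
  have hGt : 0 ≤ survSq μ t := survSq_zero μ ▸ monotone_survSq μ ht
  set ρ := (survSq μ t - survSq μ s) / 3 with hρdef
  have hρ : 0 < ρ := by rw [hρdef]; linarith
  refine (((withHighProb_empSurvSq hcont h0 hfin hρ).and
    (withHighProb_abs_ecdf_sub_le μ s (show 0 < η / 2 by linarith))).and
      (withHighProb_tttInv_one_pos hcont h0 hfin)).mono' ?_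
  filter_upwards [eventually_ne_atTop 0] with n hn x hx
  obtain ⟨⟨⟨hx0, hHn, hGn⟩, hF⟩, hpos⟩ := hx
  have hu1 : survSq μ t / survSqTotal μ ≤ 1 := by rwa [div_le_one hH]
  have hu0 : 0 ≤ survSq μ t / survSqTotal μ := by positivity
  have hcancel : survSq μ t / survSqTotal μ * survSqTotal μ = survSq μ t :=
    div_mul_cancel₀ _ hH.ne'
  refine le_trans ?_ (ecdf_le_tttBar (t := s) hn hx0 hpos hs0.le hu1 ?_)
  · linarith [(abs_le.mp hF).1]
  · have h1 := (abs_le.mp (hGn s hs0.le)).2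
    have h2 := (abs_le.mp hHn).1
    nlinarith

end InverseTransform

/-! ### Convexity of the odds and of the transform -/

section Convexity

/-- The line through a point with its right derivative as slope separates the adjacent slopes, by
the comparison principle for right derivatives. One-sided derivatives are needed because F need not
be differentiable everywhere. -/
theorem convexOn_of_monotoneOn_right_deriv {s : Set ℝ} (hs : Convex ℝ s) {f f' : ℝ → ℝ}
    (hf : ContinuousOn f s) (hf' : ∀ x ∈ s, HasDerivWithinAt f (f' x) (Ici x) x)
    (hmono : MonotoneOn f' s) : ConvexOn ℝ s f := by
  refine convexOn_of_slope_mono_adjacent hs fun {x y z} hx hz hxy hyz => ?_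
  have hoc := hs.ordConnected
  have hy : y ∈ s := hoc.out hx hz ⟨hxy.le, hyz.le⟩
  have hlin : ∀ a c r : ℝ, ∀ t, HasDerivWithinAt (fun t => c + r * (t - a)) r (Ici t) t := by
    intro a c r t
    simpa using ((((hasDerivAt_id t).sub_const a).const_mul r).const_add c).hasDerivWithinAt
  have hsub1 := hoc.out hx hy
  have hsub2 := hoc.out hy hz
  have h1 := image_le_of_deriv_right_le_deriv_boundary (hf.mono hsub1)
    (fun t ht => hf' t (hsub1 (Ico_subset_Icc_self ht)))
    (B := fun t => f x + f' y * (t - x)) (by simp) (by fun_prop) (fun t _ => hlin x (f x) (f' y) t)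
    (fun t ht => hmono (hsub1 (Ico_subset_Icc_self ht)) hy ht.2.le) (right_mem_Icc.mpr hxy.le)
  have h2 := image_le_of_deriv_right_le_deriv_boundary (f := fun t => f y + f' y * (t - y))
    (by fun_prop) (fun t _ => hlin y (f y) (f' y) t) (B := f) (by simp) (hf.mono hsub2)
    (fun t ht => hf' t (hsub2 (Ico_subset_Icc_self ht)))
    (fun t ht => hmono hy (hsub2 (Ico_subset_Icc_self ht)) ht.1) (right_mem_Icc.mpr hyz.le)
  calc (f y - f x) / (y - x) ≤ f' y := by
        rw [div_le_iff₀ (sub_pos.mpr hxy)]; linarith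
    _ ≤ (f z - f y) / (z - y) := by
        rw [le_div_iff₀ (sub_pos.mpr hyz)]; linarith

variable {μ : Measure ℝ}

theorem hasDerivAt_survSq (hcont : Continuous (cdf μ)) (x : ℝ) :
    HasDerivAt (survSq μ) ((1 - cdf μ x) ^ 2) x := by
  have hc : Continuous fun s => (1 - cdf μ s) ^ 2 := by fun_prop
  exact (hc.integral_hasStrictDerivAt 0 x).hasDerivAt

/-- The chord condition says that T = F ∘ G⁻¹ is convex on the image under G of {F < 1}. Then T has
an increasing right derivative T'₊, the chain rule gives F the right derivative T'₊(G)(1 - F)², and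
the quotient rule gives the odds the right derivative T'₊(G), which is increasing. -/
theorem isIOR_of_chord_le (hcont : Continuous (cdf μ))
    (hchord : ∀ x y z, x < y → y < z → cdf μ z < 1 →
      cdf μ y * (survSq μ z - survSq μ x) ≤
        (survSq μ z - survSq μ y) * cdf μ x + (survSq μ y - survSq μ x) * cdf μ z) :
    IsIOR μ := by
  set A : Set ℝ := {x | cdf μ x < 1} with hA
  have hAopen : IsOpen A := isOpen_lt hcont continuous_const
  have hAoc : A.OrdConnected :=
    ⟨fun _ _ _ hz _ ht => (monotone_cdf μ ht.2).trans_lt hz⟩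
  have hmonoG : StrictMonoOn (survSq μ) A := fun x _ y hy hxy => survSq_lt μ hxy hy
  have hGcont : Continuous (survSq μ) :=
    continuous_iff_continuousAt.mpr fun x => (hasDerivAt_survSq hcont x).continuousAt
  have hBoc : (survSq μ '' A).OrdConnected :=
    (hAoc.isPreconnected.image _ hGcont.continuousOn).ordConnected
  set T : ℝ → ℝ := fun v => cdf μ (Function.invFunOn (survSq μ) A v) with hT
  have hTG : ∀ x ∈ A, T (survSq μ x) = cdf μ x := fun x hx => by
    rw [hT]; simp only [hmonoG.injOn.leftInvOn_invFunOn hx]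
  have hTconv : ConvexOn ℝ (survSq μ '' A) T := by
    refine convexOn_of_slope_mono_adjacent hBoc.convex fun {u v w} hu hw huv hvw => ?_
    have hv := hBoc.out hu hw ⟨huv.le, hvw.le⟩
    obtain ⟨x, hx, rfl⟩ := hu
    obtain ⟨y, hy, rfl⟩ := hv
    obtain ⟨z, hz, rfl⟩ := hw
    rw [hTG x hx, hTG y hy, hTG z hz, div_le_div_iff₀ (sub_pos.mpr huv) (sub_pos.mpr hvw)]
    have := hchord x y z ((hmonoG.lt_iff_lt hx hy).mp huv) ((hmonoG.lt_iff_lt hy hz).mp hvw) hz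
    linarith
  have hint : ∀ x ∈ A, survSq μ x ∈ interior (survSq μ '' A) := by
    intro x hx
    have hev : ∀ᶠ s in 𝓝[>] x, s ∈ A := nhdsWithin_le_nhds (hAopen.mem_nhds hx)
    obtain ⟨z, hz, hxz⟩ := (hev.and self_mem_nhdsWithin).exists
    -- {F < 1} is an open lower set, so it has points on both sides of x.
    have hy : x - 1 ∈ A := (monotone_cdf μ (by linarith)).trans_lt hx
    refine mem_interior_iff_mem_nhds.mpr (mem_of_superset
      (Icc_mem_nhds (hmonoG hy hx (by linarith)) (hmonoG hx hz hxz)) ?_)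
    exact hBoc.out (mem_image_of_mem _ hy) (mem_image_of_mem _ hz)
  have hF' : ∀ x ∈ A, HasDerivWithinAt (cdf μ)
      (derivWithin T (Ioi (survSq μ x)) (survSq μ x) * (1 - cdf μ x) ^ 2) (Ici x) x := by
    intro x hx
    have h1 := (hTconv.hasDerivWithinAt_rightDeriv_of_mem_interior (hint x hx)).Ici_of_Ioi
    have h2 := h1.comp x (hasDerivAt_survSq hcont x).hasDerivWithinAt
      (fun y hy => monotone_survSq μ hy : MapsTo (survSq μ) (Ici x) (Ici (survSq μ x)))
    refine h2.congr_of_eventuallyEq ?_ (hTG x hx).symm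
    filter_upwards [nhdsWithin_le_nhds (hAopen.mem_nhds hx)] with y hy
    exact (hTG y hy).symm
  refine convexOn_of_monotoneOn_right_deriv
    (f' := fun x => derivWithin T (Ioi (survSq μ x)) (survSq μ x)) hAoc.convex ?_ ?_ ?_
  · exact hcont.continuousOn.div (by fun_prop) fun x hx => (sub_pos.mpr hx).ne'
  · intro x hx
    have hne : 1 - cdf μ x ≠ 0 := (sub_pos.mpr hx).ne'
    have h := (hF' x hx).fun_div ((hF' x hx).const_sub 1) hne
    refine h.congr_deriv ?_
    field_simp
    ring
  · intro x hx y hy hxy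
    exact hTconv.monotoneOn_rightDeriv (hint x hx) (hint y hy) (monotone_survSq μ hxy)

/-- Convexity on all of {F < 1} reduces to chords starting at x ≥ 0, because F vanishes on the
negative half-line. -/
theorem exists_chord_lt (hcont : Continuous (cdf μ)) (h0 : cdf μ 0 = 0) (h : ¬ IsIOR μ) :
    ∃ x y z, 0 ≤ x ∧ x < y ∧ y < z ∧ cdf μ z < 1 ∧
      (survSq μ z - survSq μ y) * cdf μ x + (survSq μ y - survSq μ x) * cdf μ z <
        cdf μ y * (survSq μ z - survSq μ x) := by
  by_contra! hcon
  refine h (isIOR_of_chord_le hcont fun x y z hxy hyz hz => ?_)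
  rcases le_or_gt 0 x with hx | hx
  · exact hcon x y z hx hxy hyz hz
  have hneg : ∀ t, t ≤ 0 → cdf μ t = 0 := fun t ht =>
    le_antisymm (h0 ▸ monotone_cdf μ ht) (cdf_nonneg μ t)
  have hGxy := monotone_survSq μ hxy.le
  rcases le_or_gt y 0 with hy | hy
  · rw [hneg x hx.le, hneg y hy]
    have := mul_nonneg (sub_nonneg.mpr hGxy) (cdf_nonneg μ z)
    linarith
  -- Moving the left endpoint from 0 to x < 0 adds F(y)(G(0) - G(x)) on the left and the larger
  -- F(z)(G(0) - G(x)) on the right.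
  · have h1 := hcon 0 y z le_rfl hy hyz hz
    have h2 := monotone_survSq μ hx.le
    have h3 := monotone_cdf μ hyz.le
    rw [h0] at h1
    rw [hneg x hx.le]
    nlinarith

end Convexity

/-! ### The LL(1) calibration -/

section LogLogistic

theorem cdf_ll1_of_nonneg {t : ℝ} (ht : 0 ≤ t) : cdf ll1 t = t / (1 + t) := by
  rw [cdf_ll1]
  rcases ht.eq_or_lt with rfl | ht
  · simp
  · rw [if_pos ht]

theorem cdf_ll1_zero : cdf ll1 0 = 0 := by simp [cdf_ll1]

theorem continuous_cdf_ll1 : Continuous (cdf ll1) := by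
  have h : (cdf ll1 : ℝ → ℝ) = fun x => max x 0 / (1 + max x 0) := by
    funext x
    rw [cdf_ll1]
    split_ifs with hx
    · rw [max_eq_left hx.le]
    · rw [max_eq_right (not_lt.mp hx)]; simp
  rw [h]
  refine Continuous.div (by fun_prop) (by fun_prop) fun x => ?_
  have := le_max_right x 0
  positivity

theorem hasDerivAt_div_one_add {t : ℝ} (ht : 0 ≤ t) :
    HasDerivAt (fun s : ℝ => s / (1 + s)) ((1 - cdf ll1 t) ^ 2) t := by
  have hne : 1 + t ≠ 0 := by positivity
  refine ((hasDerivAt_id t).div ((hasDerivAt_id t).const_add 1) hne).congr_deriv ?_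
  rw [cdf_ll1_of_nonneg ht]
  simp only [id]
  field_simp
  ring

theorem survSq_ll1 {t : ℝ} (ht : 0 ≤ t) : survSq ll1 t = t / (1 + t) := by
  rw [survSq, intervalIntegral.integral_eq_sub_of_hasDerivAt (f := fun s : ℝ => s / (1 + s))]
  · simp
  · intro s hs
    rw [uIcc_of_le ht] at hs
    exact hasDerivAt_div_one_add hs.1
  · exact (antitone_sq_one_sub_cdf ll1).intervalIntegrable

theorem tendsto_div_one_add : Tendsto (fun s : ℝ => s / (1 + s)) atTop (𝓝 1) := by
  refine (tendsto_cdf_atTop ll1).congr' ?_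
  filter_upwards [eventually_ge_atTop 0] with t ht using cdf_ll1_of_nonneg ht

theorem integrableOn_sq_one_sub_cdf_ll1 :
    IntegrableOn (fun x => (1 - cdf ll1 x) ^ 2) (Ioi 0) volume :=
  integrableOn_Ioi_deriv_of_nonneg' (fun _ ht => hasDerivAt_div_one_add ht)
    (fun _ _ => sq_nonneg _) tendsto_div_one_add

theorem survSqTotal_ll1 : survSqTotal ll1 = 1 := by
  rw [survSqTotal, integral_Ioi_of_hasDerivAt_of_nonneg'
    (fun _ ht => hasDerivAt_div_one_add ht) (fun _ _ => sq_nonneg _) tendsto_div_one_add]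
  simp

theorem withHighProb_abs_tttBar_sub_le_ll1 {p η : ℝ} (hp0 : 0 ≤ p) (hp1 : p < 1) (hη : 0 < η) :
    WithHighProb ll1 fun _ x => |tttBar x p - p| ≤ η := by
  obtain ⟨t, ht0, ht⟩ := exists_cdf_eq continuous_cdf_ll1 cdf_ll1_zero hp0 hp1
  have hG : survSq ll1 t / survSqTotal ll1 = p := by
    rw [survSqTotal_ll1, div_one, survSq_ll1 ht0, ← cdf_ll1_of_nonneg ht0, ht]
  have h1 := withHighProb_tttBar_le continuous_cdf_ll1 cdf_ll1_zero
    integrableOn_sq_one_sub_cdf_ll1 ht0 (ht.trans_lt hp1) hη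
  have h2 := withHighProb_le_tttBar continuous_cdf_ll1 cdf_ll1_zero
    integrableOn_sq_one_sub_cdf_ll1 ht0 (ht.trans_lt hp1) hη
  rw [hG, ht] at h1 h2
  refine (h1.and h2).mono' (Eventually.of_forall fun n x hx => ?_)
  rw [abs_le]
  constructor <;> linarith [hx.1, hx.2]

/-- Monotonicity upgrades closeness on a grid to uniform closeness. The grid omits 1, where
consistency is unavailable since F never reaches 1; there the bound `tttBar x u ≤ 1` suffices. -/
theorem abs_tttBar_sub_le_of_grid {n : ℕ} {x : Fin n → ℝ} (hH : 0 < tttInv x 1) {m : ℕ}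
    (hm : m ≠ 0) {η : ℝ} (hη : 0 ≤ η)
    (h : ∀ j < m, |tttBar x ((j : ℝ) / m) - (j : ℝ) / m| ≤ η) {u : ℝ} (hu : u ∈ Icc (0 : ℝ) 1) :
    |tttBar x u - u| ≤ 1 / m + η := by
  have hmpos : (0 : ℝ) < m := by positivity
  obtain ⟨j, hjm, hju, huj⟩ : ∃ j < m, (j : ℝ) / m ≤ u ∧ u ≤ ((j + 1 : ℕ) : ℝ) / m := by
    have hmu : 0 ≤ (m : ℝ) * u := mul_nonneg hmpos.le hu.1
    rcases hu.2.eq_or_lt with rfl | hu1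
    · refine ⟨m - 1, by omega, ?_, ?_⟩
      · rw [div_le_one hmpos]; exact_mod_cast Nat.sub_le m 1
      · rw [Nat.sub_add_cancel (Nat.one_le_iff_ne_zero.mpr hm), div_self hmpos.ne']
    · refine ⟨⌊(m : ℝ) * u⌋₊, ?_, ?_, ?_⟩
      · rw [Nat.floor_lt hmu]; nlinarith
      · rw [div_le_iff₀ hmpos, mul_comm u]; exact Nat.floor_le hmu
      · rw [le_div_iff₀ hmpos, mul_comm]; exact_mod_cast (Nat.lt_floor_add_one _).le
  have hsplit : ((j + 1 : ℕ) : ℝ) / m = (j : ℝ) / m + 1 / m := by push_cast; ring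
  have h1 := tttBar_mono hH hju hu.2
  have h2 := (abs_le.mp (h j hjm)).1
  rw [abs_le]
  refine ⟨by linarith, ?_⟩
  rcases Nat.lt_or_ge (j + 1) m with hj | hj
  · have h3 := tttBar_mono hH huj ((div_le_one hmpos).mpr (by exact_mod_cast hj.le))
    have h4 := (abs_le.mp (h (j + 1) hj)).2
    linarith
  · have h3 : ((j + 1 : ℕ) : ℝ) / m = 1 := by
      rw [show j + 1 = m by omega, div_self hmpos.ne']
    linarith [tttBar_le_one x u]

theorem withHighProb_KT_le_ll1 {η : ℝ} (hη : 0 < η) : WithHighProb ll1 fun _ x => KT x ≤ η := by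
  obtain ⟨m, hm, hm0⟩ := (((tendsto_one_div_atTop_nhds_zero_nat (𝕜 := ℝ)).eventually_le_const
    (show 0 < η / 4 by positivity)).and (eventually_ne_atTop 0)).exists
  have hmpos : (0 : ℝ) < m := by positivity
  refine ((withHighProb_tttInv_one_pos continuous_cdf_ll1 cdf_ll1_zero
    integrableOn_sq_one_sub_cdf_ll1).and (withHighProb_forall_lt
      (P := fun j _ x => |tttBar x ((j : ℝ) / m) - (j : ℝ) / m| ≤ η / 4) m fun j hj =>
        withHighProb_abs_tttBar_sub_le_ll1 (by positivity) ?_ (by positivity))).mono'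
      (Eventually.of_forall fun n x hx => ?_)
  · rw [div_lt_one hmpos]; exact_mod_cast hj
  · have := KT_le_of_abs_sub_le fun u hu =>
      abs_tttBar_sub_le_of_grid hx.1 hm0 (by positivity) hx.2 hu
    linarith

theorem IsCriticalValue.nonneg {α : ℝ} (hα : α < 1) {n : ℕ} {c : ℝ} (h : IsCriticalValue α n c) :
    0 ≤ c := by
  by_contra! hc
  have huniv : {x : Fin n → ℝ | c < KT x} = univ :=
    eq_univ_of_forall fun x => hc.trans_le (KT_nonneg x)
  have h1 := h.1
  rw [huniv, probReal_univ] at h1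
  linarith

/-- A critical value at least ε would give α ≤ P(`KT` > ε/2), which is eventually false under LL(1).
-/
theorem tendsto_criticalValue {α : ℝ} (hα0 : 0 < α) (hα1 : α < 1) {c : ℕ → ℝ}
    (hc : ∀ᶠ n in atTop, IsCriticalValue α n (c n)) : Tendsto c atTop (𝓝 0) := by
  rw [Metric.tendsto_atTop']
  intro ε hε
  have h := (withHighProb_KT_le_ll1 (half_pos hε)).tendsto_real_not.eventually (gt_mem_nhds hα0)
  obtain ⟨N, hN⟩ := eventually_atTop.mp (h.and hc)
  refine ⟨N, fun n hn => ?_⟩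
  obtain ⟨h1, h2⟩ := hN n hn.le
  rw [Real.dist_eq, sub_zero, abs_of_nonneg (h2.nonneg hα1)]
  by_contra! hlt
  refine absurd (h2.2.trans (measureReal_mono fun x hx => ?_)) h1.not_ge
  have hx' : c n ≤ KT x := hx
  exact not_le.mpr (by linarith)

end LogLogistic

/-! ### Behaviour under the alternative -/

section Alternative

variable {μ : Measure ℝ} [IsProbabilityMeasure μ]

/-- Jumps of the CDF are the masses of atoms. -/
theorem continuous_cdf [NullSingletonClass μ] : Continuous (cdf μ) := by
  refine continuous_iff_continuousAt.mpr fun a => ?_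
  rw [(monotone_cdf μ).continuousAt_iff_leftLim_eq_rightLim, (cdf μ).rightLim_eq]
  have h := (cdf μ).measure_singleton a
  rw [measure_cdf, measure_singleton] at h
  exact le_antisymm ((monotone_cdf μ).leftLim_le le_rfl)
    (sub_nonpos.mp (ENNReal.ofReal_eq_zero.mp h.symm))

theorem exists_withHighProb_le_KT (hcont : Continuous (cdf μ)) (h0 : cdf μ 0 = 0)
    (hfin : IntegrableOn (fun x => (1 - cdf μ x) ^ 2) (Ioi 0) volume) (h : ¬ IsIOR μ) :
    ∃ δ : ℝ, 0 < δ ∧ WithHighProb μ fun _ x => δ ≤ KT x := by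
  obtain ⟨r, s, t, hr, hrs, hst, htF, hlt⟩ := exists_chord_lt hcont h0 h
  have hH := survSqTotal_pos h0 hcont hfin
  have hsF := (monotone_cdf μ hst.le).trans_lt htF
  have hrF := (monotone_cdf μ hrs.le).trans_lt hsF
  have hs := hr.trans hrs.le
  have ht := hs.trans hst.le
  have hGrs := survSq_lt μ hrs hsF
  have hGst := survSq_lt μ hst htF
  have hGrt : 0 < survSq μ t - survSq μ r := by linarith
  have hmem : ∀ y, 0 ≤ y → survSq μ y / survSqTotal μ ∈ Icc (0 : ℝ) 1 := fun y hy =>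
    ⟨div_nonneg (survSq_zero μ ▸ monotone_survSq μ hy) hH.le,
      (div_le_one hH).mpr (survSq_le_total hfin hy)⟩
  set a := (survSq μ t - survSq μ s) / (survSq μ t - survSq μ r) with ha
  set b := (survSq μ s - survSq μ r) / (survSq μ t - survSq μ r) with hb
  have ha0 : 0 ≤ a := div_nonneg (by linarith) hGrt.le
  have hb0 : 0 ≤ b := div_nonneg (by linarith) hGrt.le
  have hab : a + b = 1 := by rw [ha, hb]; field_simp; ring
  have hw : a * (survSq μ r / survSqTotal μ) + b * (survSq μ t / survSqTotal μ) =
      survSq μ s / survSqTotal μ := by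
    rw [ha, hb]; field_simp; ring
  have hgap : 0 < cdf μ s - (a * cdf μ r + b * cdf μ t) := by
    rw [sub_pos, ha, hb, div_mul_eq_mul_div, div_mul_eq_mul_div, ← add_div, div_lt_iff₀ hGrt]
    exact hlt
  set g := cdf μ s - (a * cdf μ r + b * cdf μ t) with hg
  -- Of the chord gap g, estimating T at the middle point costs g/4 and the chord another g/4.
  refine ⟨g / 2, half_pos hgap, ?_⟩
  have hg4 : 0 < g / 4 := by positivity
  refine ((withHighProb_le_tttBar hcont h0 hfin hs hsF hg4).and
    ((withHighProb_tttBar_le hcont h0 hfin hr hrF hg4).and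
      (withHighProb_tttBar_le hcont h0 hfin ht htF hg4))).mono'
        (Eventually.of_forall fun n x hx => ?_)
  obtain ⟨h1, h2, h3⟩ := hx
  have hK := sub_chord_le_KT x (hmem r hr) (hmem t ht) ha0 hb0 hab
  rw [hw] at hK
  have h2' := mul_le_mul_of_nonneg_left h2 ha0
  have h3' := mul_le_mul_of_nonneg_left h3 hb0
  have hsum : a * (g / 4) + b * (g / 4) = g / 4 := by rw [← add_mul, hab, one_mul]
  linarith

end Alternative

end IORTest

theorem theorem3 (μ : Measure ℝ) [IsProbabilityMeasure μ]
    (hac : μ ≪ volume) (hsupp : μ (Iio 0) = 0)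
    (hfin : IntegrableOn (fun x => (1 - cdf μ x) ^ 2) (Ioi 0) volume)
    (hH1 : ¬ IORTest.IsIOR μ)
    (α : ℝ) (hα0 : 0 < α) (hα1 : α < 1)
    (c : ℕ → ℝ) (hc : ∀ᶠ n in atTop, IORTest.IsCriticalValue α n (c n)) :
    Tendsto (fun n => (IORTest.sampleLaw μ n).real {x | c n < IORTest.KT x}) atTop (𝓝 1) ∧
      Tendsto c atTop (𝓝 0) ∧
      ∃ δ : ℝ, 0 < δ ∧
        Tendsto (fun n => (IORTest.sampleLaw μ n).real {x | δ ≤ IORTest.KT x}) atTop (𝓝 1) := by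
  have : NullSingletonClass μ := ⟨fun a => hac Real.volume_singleton⟩
  have hcont : Continuous (cdf μ) := IORTest.continuous_cdf
  have h0 : cdf μ 0 = 0 := by
    rw [cdf_eq_real, measureReal_def, measure_congr Iio_ae_eq_Iic.symm, hsupp, ENNReal.toReal_zero]
  have hc0 := IORTest.tendsto_criticalValue hα0 hα1 hc
  obtain ⟨δ, hδ, hP⟩ := IORTest.exists_withHighProb_le_KT hcont h0 hfin hH1
  refine ⟨(hP.mono' ?_).tendsto_real, hc0, δ, hδ, hP.tendsto_real⟩
  filter_upwards [hc0.eventually (gt_mem_nhds hδ)] with n hn x hx using hn.trans_le hx
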